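/- Let $K,L\subset\mathbb R^2$ be origin-symmetric convex integer polygons, i.e. $K=-K$, $L=-L$, and each of $K,L$ is the convex hull of finitely many points of $\mathbb Z^2$ and has nonempty interior. For $A\subset\mathbb R^2$ and $u\in\mathbb R^2$ let $A|u^\perp$ be the orthogonal projection of $A$ onto $u^\perp=\{x\in\mathbb R^2:\langle x,u\rangle=0\}$, and let $|\cdot|$ denote the number of points of a set. For $u\in\mathbb Z^2$ consider the condition $$|(K\cap\mathbb Z^2)|u^\perp|=|(L\cap\mathbb Z^2)|u^\perp|\quad\text{and}\quad |(2K\cap\mathbb Z^2)|u^\perp|=|(2L\cap\mathbb Z^2)|u^\perp|.\qquad(*)$$ (a) If $(*)$ holds for every nonzero $u\in\mathbb Z^2$, then $K=L$. (b) More generally, let $D_1K$ be the set of all $u\in\mathbb Z^2$ that are real multiples of $y-x$ for some distinct $x,y\in K\cap\mathbb Z^2$, and define $D_1L$ likewise. If $(*)$ holds for every nonzero $u\in\mathbb Z^2$ that is parallel to an edge of $K$ or to an edge of $L$, and also for at least one $u=\xi\in\mathbb Z^2\setminus(D_1K\cup D_1L)$, then $K=L$. -/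

import Mathlib

open scoped Pointwise

noncomputable section

/-- The Euclidean plane. -/
abbrev Plane : Type := EuclideanSpace ℝ (Fin 2)

/-- The integer lattice `ℤ²`, as a subset of the plane. -/
def latticeZ2 : Set Plane := {x | ∀ i, ∃ n : ℤ, x i = (n : ℝ)}

/-- A convex integer polygon: the convex hull of finitely many points of `ℤ²` (equivalently, a
convex polytope all of whose vertices lie in `ℤ²`) that has nonempty interior. -/
def IsConvexIntegerPolygon (K : Set Plane) : Prop :=
  (∃ V : Set Plane, V.Finite ∧ V ⊆ latticeZ2 ∧ K = convexHull ℝ V) ∧ (interior K).Nonempty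

/-- `A | u^⊥`: the orthogonal projection of `A` onto the orthogonal complement
`u^⊥ = {x | ⟪x, u⟫ = 0}` of `u`. -/
def projPerp (A : Set Plane) (u : Plane) : Set Plane :=
  (fun x => (Submodule.span ℝ {u})ᗮ.starProjection x) '' A

/-- The number of points of `(K ∩ ℤ²) | u^⊥`. -/
def projCard (K : Set Plane) (u : Plane) : ℕ∞ :=
  (projPerp (K ∩ latticeZ2) u).encard

/-- The set `D₁K` of all integer vectors parallel to a segment joining two distinct lattice points
of `K`. It contains the zero vector as soon as `K` contains two lattice points. -/
def D1 (K : Set Plane) : Set Plane :=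
  {u | u ∈ latticeZ2 ∧ ∃ x ∈ K ∩ latticeZ2, ∃ y ∈ K ∩ latticeZ2,
    x ≠ y ∧ ∃ t : ℝ, u = t • (y - x)}

/-- The segment `[x, y]` is an edge of the polygon `K`: it is nondegenerate, and it is a face of
`K`, that is, the set of points of `K` at which some linear functional attains its maximum
over `K`. -/
def IsEdge (K : Set Plane) (x y : Plane) : Prop :=
  x ≠ y ∧ IsExposed ℝ K (segment ℝ x y)

/-- The nonzero vector `u` is parallel to an edge of `K`. -/
def IsEdgeDirection (K : Set Plane) (u : Plane) : Prop :=
  u ≠ 0 ∧ ∃ x y : Plane, IsEdge K x y ∧ ∃ t : ℝ, u = t • (y - x)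

/-- The two equalities of the numbers of projected points, in the direction `u`: for `K` and `L`,
and for `2K` and `2L`. -/
def SameProjCards (K L : Set Plane) (u : Plane) : Prop :=
  projCard K u = projCard L u ∧ projCard ((2 : ℝ) • K) u = projCard ((2 : ℝ) • L) u

end

open Filter Topology

/-! The edge directions of `K` already force `L ⊆ K`; equality follows by symmetry. Suppose a point
`p` of the finite set generating `L` lies outside `K`. An edge of `K` cuts it off; let `u` be its
primitive direction and `wedge u = ±N` the lines of this edge and its opposite. Each integer line
between them meets `K` in a chord at least as long as `u`, so `K` occupies exactly the levels `-N,
..., N` (`levels_eq_Icc`), while `2K` occupies at most `4N + 1` levels. Let `A` be the level set of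
`L`. Then `|A| = 2N + 1`, and `A + A` lies in the level set of `2L`, which has at most `4N + 1`
elements. This is equality in `|A + A| ≥ 2|A| - 1`, so `A` is a progression, centred at `0` by
symmetry, with some step `d`, and `2L` has levels exactly `A + A`. The lattice points of `2L`
generate `ℤ²` (`dvd_of_forall_levels`), hence `d = ±1` and `A = [-N, N]`, contradicting the level of
`p`. -/

/-- The functional `x ↦ det (q, x)`. -/
noncomputable def wedge (q : Plane) : Plane →L[ℝ] ℝ :=
  q 0 • EuclideanSpace.proj 1 - q 1 • EuclideanSpace.proj 0

theorem wedge_apply (q x : Plane) : wedge q x = q 0 * x 1 - q 1 * x 0 := by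
  simp [wedge]

theorem wedge_self (q : Plane) : wedge q q = 0 := by
  rw [wedge_apply]; ring

theorem wedge_comm (q x : Plane) : wedge q x = -wedge x q := by
  simp only [wedge_apply]; ring

theorem wedge_add_left (q r x : Plane) : wedge (q + r) x = wedge q x + wedge r x := by
  simp only [wedge_apply, PiLp.add_apply]; ring

theorem wedge_smul_left (t : ℝ) (q x : Plane) : wedge (t • q) x = t * wedge q x := by
  simp only [wedge_apply, PiLp.smul_apply, smul_eq_mul]; ring

/-- Coordinates of `x` with respect to a basis `u, z` of determinant one. -/
theorem eq_of_wedge_eq_one {u z : Plane} (h : wedge u z = 1) (x : Plane) :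
    x = wedge u x • z + wedge x z • u := by
  simp only [wedge_apply] at h ⊢
  ext i
  fin_cases i
  · simp only [Fin.zero_eta, PiLp.add_apply, PiLp.smul_apply, smul_eq_mul]
    linear_combination (-x 0) * h
  · simp only [Fin.mk_one, PiLp.add_apply, PiLp.smul_apply, smul_eq_mul]
    linear_combination (-x 1) * h

/-- Cramer's rule. -/
theorem wedge_smul_eq (a b x : Plane) :
    wedge a b • x = wedge x b • a + wedge a x • b := by
  simp only [wedge_apply]
  ext i
  fin_cases i
  · simp only [Fin.zero_eta, PiLp.add_apply, PiLp.smul_apply, smul_eq_mul]; ring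
  · simp only [Fin.mk_one, PiLp.add_apply, PiLp.smul_apply, smul_eq_mul]; ring

theorem zero_mem_interior_of_eq_neg {K : Set Plane} (hc : Convex ℝ K) (hs : K = -K)
    (hi : (interior K).Nonempty) : (0 : Plane) ∈ interior K := by
  obtain ⟨x, hx⟩ := hi
  have hx' : -x ∈ interior K := by
    have : interior K = -interior K := by
      conv_lhs => rw [hs]
      exact ((Homeomorph.neg Plane).preimage_interior K).symm
    rw [this]; simpa using hx
  have := hc.interior hx hx' (a := 1/2) (b := 1/2) (by norm_num) (by norm_num) (by norm_num)
  simpa using this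

/-! ### Polar duality and separation by edges. -/

/-- The polar body of `V`, with the plane identified with its dual by `wedge`. -/
def wedgePolar (V : Set Plane) : Set Plane := {q | ∀ v ∈ V, wedge q v ≤ 1}

theorem le_one_of_mem_wedgePolar {V : Set Plane} {q : Plane} (hq : q ∈ wedgePolar V) {x : Plane}
    (hx : x ∈ convexHull ℝ V) : wedge q x ≤ 1 :=
  convexHull_min (t := {x | wedge q x ≤ 1}) hq
    (convex_halfSpace_le (wedge q).toLinearMap.isLinear 1) hx

/-- The hull contains a ball of radius `r` about `0`; testing `q` against its own quarter turn,
rescaled into that ball, bounds `‖q‖` by `2 / r`. -/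
theorem isCompact_wedgePolar {V : Set Plane} (h0 : (0 : Plane) ∈ interior (convexHull ℝ V)) :
    IsCompact (wedgePolar V) := by
  apply Metric.isCompact_of_isClosed_isBounded
  · have : wedgePolar V = ⋂ v ∈ V, {q | wedge q v ≤ 1} := by
      ext q; simp [wedgePolar]
    rw [this]
    refine isClosed_biInter fun v _ => isClosed_le ?_ continuous_const
    simp only [wedge_apply]
    fun_prop
  · obtain ⟨r, hr, hb⟩ := Metric.mem_nhds_iff.1 (mem_interior_iff_mem_nhds.1 h0)
    refine (Metric.isBounded_iff_subset_closedBall 0).2 ⟨2 / r, fun q hq => ?_⟩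
    rw [mem_closedBall_zero_iff]
    by_cases hq0 : q = 0
    · subst hq0; simp; positivity
    have hn : 0 < ‖q‖ := norm_pos_iff.2 hq0
    have hsq : ‖q‖ ^ 2 = q 0 ^ 2 + q 1 ^ 2 := by
      rw [EuclideanSpace.norm_sq_eq]; simp
    set j : Plane := !₂[-q 1, q 0] with hj
    have hjn : ‖j‖ = ‖q‖ := by
      have : ‖j‖ ^ 2 = ‖q‖ ^ 2 := by
        rw [hsq, EuclideanSpace.norm_sq_eq]; simp [hj]; ring
      exact (pow_left_inj₀ (norm_nonneg _) (norm_nonneg _) two_ne_zero).1 this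
    have hmem : (r / 2 / ‖q‖) • j ∈ convexHull ℝ V := by
      apply hb
      rw [mem_ball_zero_iff, norm_smul, hjn, Real.norm_eq_abs, abs_of_pos (by positivity)]
      field_simp
      linarith
    have h1 := le_one_of_mem_wedgePolar hq hmem
    have hcj : wedge q j = ‖q‖ ^ 2 := by
      rw [wedge_apply, hsq]; simp [hj]; ring
    rw [map_smul, smul_eq_mul, hcj] at h1
    have : r / 2 * ‖q‖ ≤ 1 := by
      calc r / 2 * ‖q‖ = r / 2 / ‖q‖ * ‖q‖ ^ 2 := by field_simp
        _ ≤ 1 := h1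
    rw [le_div_iff₀ hr]; linarith

theorem exists_wedgePolar_gt {V : Set Plane} (hV : V.Finite)
    (h0 : (0 : Plane) ∈ interior (convexHull ℝ V)) {p : Plane} (hp : p ∉ convexHull ℝ V) :
    ∃ q ∈ wedgePolar V, 1 < wedge q p := by
  obtain ⟨f, s, hf, hs⟩ := geometric_hahn_banach_closed_point (convex_convexHull ℝ V)
    (hV.isCompact_convexHull (𝕜 := ℝ)).isClosed hp
  have hs0 : 0 < s := by simpa using hf 0 (interior_subset h0)
  set e0 : Plane := EuclideanSpace.single 0 1
  set e1 : Plane := EuclideanSpace.single 1 1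
  have key : ∀ x, wedge !₂[s⁻¹ * f e1, -(s⁻¹ * f e0)] x = s⁻¹ * f x := by
    intro x
    have hx : x = x 0 • e0 + x 1 • e1 := by
      ext i; fin_cases i <;> simp [e0, e1]
    rw [wedge_apply]
    conv_rhs => rw [hx, map_add, map_smul, map_smul]
    simp
    ring
  refine ⟨!₂[s⁻¹ * f e1, -(s⁻¹ * f e0)], fun v hv => ?_, ?_⟩
  · rw [key, inv_mul_le_iff₀ hs0, mul_one]
    exact (hf v (subset_convexHull ℝ V hv)).le
  · rw [key, lt_inv_mul_iff₀ hs0, mul_one]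
    exact hs

/-- If all tight constraints were parallel, some `h ≠ 0` would leave them unchanged, and `q ± εh`
would stay in the polar, so `q` would not be extreme. -/
theorem exists_tight_of_mem_extremePoints {V : Set Plane} (hV : V.Finite) {q : Plane}
    (hq : q ∈ (wedgePolar V).extremePoints ℝ) :
    ∃ v ∈ V, ∃ w ∈ V, wedge q v = 1 ∧ wedge q w = 1 ∧ wedge v w ≠ 0 := by
  by_contra! hcon
  obtain ⟨h, hh0, hh⟩ : ∃ h : Plane, h ≠ 0 ∧ ∀ v ∈ V, wedge q v = 1 → wedge h v = 0 := by
    by_cases hex : ∃ v ∈ V, wedge q v = 1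
    · obtain ⟨v, hv, hv1⟩ := hex
      refine ⟨v, ?_, fun w hw hw1 => hcon v hv w hw hv1 hw1⟩
      rintro rfl
      simp at hv1
    · exact ⟨EuclideanSpace.single 0 1, by simp, fun v hv h1 => (hex ⟨v, hv, h1⟩).elim⟩
  have hev : ∀ᶠ t : ℝ in 𝓝 0, ∀ v ∈ V, wedge q v + t * wedge h v ≤ 1 := by
    refine (hV.eventually_all).2 fun v hv => ?_
    rcases (hq.1 v hv).eq_or_lt with h1 | h1
    · exact Eventually.of_forall fun t => by rw [hh v hv h1, h1]; simp
    · have : Tendsto (fun t : ℝ => wedge q v + t * wedge h v) (𝓝 0) (𝓝 (wedge q v)) := by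
        have : Continuous (fun t : ℝ => wedge q v + t * wedge h v) := by fun_prop
        simpa using this.tendsto 0
      exact (this.eventually_lt_const h1).mono fun t ht => ht.le
  obtain ⟨ε, hε, hb⟩ := Metric.eventually_nhds_iff.1 hev
  have hm : ∀ t : ℝ, |t| < ε → q + t • h ∈ wedgePolar V := fun t ht v hv => by
    rw [wedge_add_left, wedge_smul_left]
    exact hb (by simpa using ht) v hv
  have h1 := hm (ε / 2) (by rw [abs_of_pos] <;> linarith)
  have h2 := hm (-(ε / 2)) (by rw [abs_neg, abs_of_pos] <;> linarith)
  have := hq.2 h1 h2 ⟨1/2, 1/2, by norm_num, by norm_num, by norm_num, by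
    ext i; simp; ring⟩
  have h3 : (ε / 2) • h = 0 := by simpa using this
  rcases smul_eq_zero.1 h3 with h4 | h4
  · linarith
  · exact hh0 h4

/-- A point outside a polygon is cut off by the line through two vertices. -/
theorem exists_separating_edge {V : Set Plane} (hV : V.Finite)
    (h0 : (0 : Plane) ∈ interior (convexHull ℝ V)) {p : Plane} (hp : p ∉ convexHull ℝ V) :
    ∃ q, (∀ x ∈ convexHull ℝ V, wedge q x ≤ 1) ∧ 1 < wedge q p ∧
      ∃ v ∈ V, ∃ w ∈ V, wedge q v = 1 ∧ wedge q w = 1 ∧ wedge v w ≠ 0 := by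
  obtain ⟨q₀, hq₀, hq₀p⟩ := exists_wedgePolar_gt hV h0 hp
  -- The maximisers of `wedge · p` over the polar form an exposed face; by Krein–Milman it contains
  -- an extreme point of the polar.
  have hexp : IsExposed ℝ (wedgePolar V)
      {q ∈ wedgePolar V | ∀ r ∈ wedgePolar V, -wedge p r ≤ -wedge p q} :=
    fun _ => ⟨-wedge p, rfl⟩
  have hcomp := isCompact_wedgePolar h0
  obtain ⟨m, hm, hmax⟩ := hcomp.exists_isMaxOn ⟨q₀, hq₀⟩ (-wedge p).continuous.continuousOn
  obtain ⟨q, hq⟩ := (hexp.isCompact hcomp).extremePoints_nonempty ⟨m, hm, fun r hr => hmax hr⟩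
  have hqe := hexp.isExtreme.extremePoints_subset_extremePoints hq
  refine ⟨q, fun x hx => le_one_of_mem_wedgePolar hqe.1 hx, ?_,
    exists_tight_of_mem_extremePoints hV hqe⟩
  have := hq.1.2 q₀ hq₀
  rw [← wedge_comm, ← wedge_comm] at this
  linarith

/-- The face on which `q` is maximal is a compact convex part of the line through `v` and `w`, hence
a segment; its endpoints need not be `v` and `w`. -/
theorem isEdgeDirection_of_support {K : Set Plane} (hc : Convex ℝ K) (hK : IsCompact K)
    {q v w u : Plane} (hq : ∀ x ∈ K, wedge q x ≤ 1) (hv : v ∈ K) (hw : w ∈ K)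
    (hqv : wedge q v = 1) (hqw : wedge q w = 1) (hvw : wedge v w ≠ 0) (hu : u ≠ 0)
    (huw : ∃ m : ℝ, m • u = w - v) : IsEdgeDirection K u := by
  set F : Set Plane := {x ∈ K | ∀ y ∈ K, wedge q y ≤ wedge q x} with hF
  have hexp : IsExposed ℝ K F := fun _ => ⟨wedge q, rfl⟩
  have hFmem : ∀ x, x ∈ F ↔ x ∈ K ∧ wedge q x = 1 := fun x =>
    ⟨fun h => ⟨h.1, le_antisymm (hq x h.1) (hqv ▸ h.2 v hv)⟩,
      fun h => ⟨h.1, fun y hy => h.2 ▸ hq y hy⟩⟩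
  have hne : v ≠ w := by rintro rfl; exact hvw (wedge_self v)
  let ℓ : ℝ →ᵃ[ℝ] Plane := AffineMap.lineMap v w
  have hℓ : ∀ t, ℓ t = v + t • (w - v) := fun t => by
    simp [ℓ, AffineMap.lineMap_apply, add_comm]
  have hline : ∀ x, wedge q x = 1 → ∃ t, ℓ t = x := by
    intro x hx
    refine ⟨wedge v x / wedge v w, ?_⟩
    have hqid : ∀ y, wedge v w * wedge q y = wedge y w + wedge v y := by
      intro y
      have := congrArg (wedge q) (wedge_smul_eq v w y)
      simpa [hqv, hqw] using this
    have h1 : wedge x w = wedge v w - wedge v x := by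
      have := hqid x
      rw [hx] at this; linarith
    have h2 := wedge_smul_eq v w x
    rw [h1] at h2
    have h3 : x = (wedge v w)⁻¹ • ((wedge v w - wedge v x) • v + wedge v x • w) := by
      rw [← h2, smul_smul, inv_mul_cancel₀ hvw, one_smul]
    rw [hℓ, div_eq_inv_mul]
    conv_rhs => rw [h3, smul_add, smul_smul, smul_smul, mul_sub, inv_mul_cancel₀ hvw]
    module
  have hcont : Continuous ℓ := by
    have : (ℓ : ℝ → Plane) = fun t => v + t • (w - v) := funext hℓ
    rw [this]; fun_prop
  have hTconv : Convex ℝ (ℓ ⁻¹' F) := (hexp.convex hc).affine_preimage ℓ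
  have hinj : Function.Injective ℓ := AffineMap.lineMap_injective ℝ hne
  have himg : ℓ '' (ℓ ⁻¹' F) = F := by
    refine Set.image_preimage_eq_of_subset fun x hx => ?_
    exact hline x ((hFmem x).1 hx).2
  have hTcomp : IsCompact (ℓ ⁻¹' F) := by
    have : ℓ ⁻¹' F = (fun x => (wedge v w)⁻¹ * wedge v x) '' F := by
      have hl : ∀ t, (wedge v w)⁻¹ * wedge v (ℓ t) = t := fun t => by
        rw [hℓ, map_add, map_smul, map_sub, wedge_self, smul_eq_mul]
        field_simp
        ring
      conv_rhs => rw [← himg, Set.image_image]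
      simp only [hl, Set.image_id']
    rw [this]
    exact (hexp.isCompact hK).image (by fun_prop)
  have h0T : (0 : ℝ) ∈ ℓ ⁻¹' F := by
    simpa [ℓ] using (hFmem v).2 ⟨hv, hqv⟩
  have h1T : (1 : ℝ) ∈ ℓ ⁻¹' F := by
    simpa [ℓ] using (hFmem w).2 ⟨hw, hqw⟩
  have hIcc := eq_Icc_of_connected_compact (hTconv.isConnected ⟨0, h0T⟩) hTcomp
  generalize sInf (ℓ ⁻¹' F) = a at hIcc
  generalize sSup (ℓ ⁻¹' F) = b at hIcc
  rw [hIcc] at h0T h1T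
  have hab : a < b := by
    have := h0T.1; have := h1T.2; linarith
  refine ⟨hu, ℓ a, ℓ b, ⟨fun h => hab.ne (hinj h), ?_⟩, ?_⟩
  · have : segment ℝ (ℓ a) (ℓ b) = F := by
      rw [← himg, hIcc, ← segment_eq_Icc hab.le, image_segment]
    rw [this]; exact hexp
  · obtain ⟨m, hm⟩ := huw
    have hm0 : m ≠ 0 := by
      rintro rfl
      rw [zero_smul] at hm
      exact hne (sub_eq_zero.1 hm.symm).symm
    refine ⟨(m * (b - a))⁻¹, ?_⟩
    have hba : b - a ≠ 0 := by linarith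
    have : ℓ b - ℓ a = (m * (b - a)) • u := by
      rw [hℓ, hℓ, ← hm]; module
    rw [this, smul_smul, inv_mul_cancel₀ (mul_ne_zero hm0 hba), one_smul]

/-! ### Lattice bases, and projections counted as integer levels. -/

theorem zero_mem_latticeZ2 : (0 : Plane) ∈ latticeZ2 := fun i => ⟨0, by simp⟩

theorem add_mem_latticeZ2 {x y : Plane} (hx : x ∈ latticeZ2) (hy : y ∈ latticeZ2) :
    x + y ∈ latticeZ2 := fun i => by
  obtain ⟨a, ha⟩ := hx i
  obtain ⟨b, hb⟩ := hy i
  exact ⟨a + b, by simp [ha, hb]⟩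

theorem zsmul_mem_latticeZ2 {x : Plane} (hx : x ∈ latticeZ2) (n : ℤ) :
    (n : ℝ) • x ∈ latticeZ2 := fun i => by
  obtain ⟨a, ha⟩ := hx i
  exact ⟨n * a, by simp [ha]⟩

theorem neg_mem_latticeZ2 {x : Plane} (hx : x ∈ latticeZ2) : -x ∈ latticeZ2 := by
  simpa using zsmul_mem_latticeZ2 hx (-1)

theorem sub_mem_latticeZ2 {x y : Plane} (hx : x ∈ latticeZ2) (hy : y ∈ latticeZ2) :
    x - y ∈ latticeZ2 := by
  rw [sub_eq_add_neg]; exact add_mem_latticeZ2 hx (neg_mem_latticeZ2 hy)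

theorem exists_int_wedge {u x : Plane} (hu : u ∈ latticeZ2) (hx : x ∈ latticeZ2) :
    ∃ n : ℤ, wedge u x = n := by
  obtain ⟨a, ha⟩ := hu 0
  obtain ⟨b, hb⟩ := hu 1
  obtain ⟨c, hc⟩ := hx 0
  obtain ⟨d, hd⟩ := hx 1
  exact ⟨a * d - b * c, by simp [wedge_apply, ha, hb, hc, hd]⟩

/-- Every nonzero lattice vector is a multiple of a member of a lattice basis. -/
theorem exists_primitive {x : Plane} (hx : x ∈ latticeZ2) (h0 : x ≠ 0) :
    ∃ u ∈ latticeZ2, ∃ z ∈ latticeZ2, ∃ m : ℤ, 1 ≤ m ∧ (m : ℝ) • u = x ∧ wedge u z = 1 := by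
  obtain ⟨a, ha⟩ := hx 0
  obtain ⟨b, hb⟩ := hx 1
  have hg : 0 < Int.gcd a b := by
    rw [Nat.pos_iff_ne_zero, Ne, Int.gcd_eq_zero_iff]
    rintro ⟨rfl, rfl⟩
    apply h0
    ext i; fin_cases i <;> simp [ha, hb]
  obtain ⟨a', ha'⟩ := Int.gcd_dvd_left a b
  obtain ⟨b', hb'⟩ := Int.gcd_dvd_right a b
  have hbez := Int.gcd_eq_gcd_ab a b
  set g : ℤ := (Int.gcd a b : ℤ) with hgdef
  have hg' : 0 < g := Int.natCast_pos.2 hg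
  have h1 : a' * Int.gcdA a b + b' * Int.gcdB a b = 1 := by
    have : g * (a' * Int.gcdA a b + b' * Int.gcdB a b) = g * 1 := by
      calc _ = (g * a') * Int.gcdA a b + (g * b') * Int.gcdB a b := by ring
        _ = g * 1 := by rw [← ha', ← hb', mul_one]; exact hbez.symm
    exact mul_left_cancel₀ hg'.ne' this
  refine ⟨!₂[(a' : ℝ), (b' : ℝ)], ?_,
    !₂[-(Int.gcdB a b : ℝ), (Int.gcdA a b : ℝ)], ?_, g, by omega, ?_, ?_⟩
  · intro i; fin_cases i
    · exact ⟨a', by simp⟩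
    · exact ⟨b', by simp⟩
  · intro i; fin_cases i
    · exact ⟨-Int.gcdB a b, by simp⟩
    · exact ⟨Int.gcdA a b, by simp⟩
  · ext i; fin_cases i
    · simp only [Fin.zero_eta, PiLp.smul_apply, smul_eq_mul, ha, Matrix.cons_val_zero]
      exact_mod_cast ha'.symm
    · simp only [Fin.mk_one, PiLp.smul_apply, smul_eq_mul, hb, Matrix.cons_val_one,
        Matrix.cons_val_fin_one]
      exact_mod_cast hb'.symm
  · simp only [wedge_apply, Matrix.cons_val_zero, Matrix.cons_val_one,
      mul_neg, sub_neg_eq_add]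
    exact_mod_cast h1

/-- The integers `n` for which the line `wedge u x = n` contains a lattice point of `K`. -/
def levels (K : Set Plane) (u : Plane) : Set ℤ :=
  {n | ∃ x ∈ K ∩ latticeZ2, wedge u x = n}

theorem encard_image_eq_of_fibers {α β γ : Type*} {f : α → β} {g : α → γ} (s : Set α)
    (h : ∀ x y, f x = f y ↔ g x = g y) : (f '' s).encard = (g '' s).encard := by
  rw [← Set.InjOn.encard_image (f := fun b : β => {c | ∃ x, f x = b ∧ g x = c}) (s := f '' s),
    ← Set.InjOn.encard_image (f := fun c : γ => ({c} : Set γ)) (s := g '' s)]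
  · rw [Set.image_image, Set.image_image]
    congr 1
    refine Set.image_congr fun x _ => ?_
    ext c
    constructor
    · rintro ⟨y, hy, rfl⟩; exact (h y x).1 hy
    · rintro rfl; exact ⟨x, rfl, rfl⟩
  · intro a _ b _ hab; simpa using hab
  · rintro _ ⟨x, _, rfl⟩ _ ⟨y, _, rfl⟩ hxy
    have : g x ∈ {c | ∃ z, f z = f y ∧ g z = c} := by
      rw [← show _ = {c | ∃ z, f z = f y ∧ g z = c} from hxy]; exact ⟨x, rfl, rfl⟩
    obtain ⟨z, hz, hzx⟩ := this
    rw [← hz]; exact (h x z).2 hzx.symm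

theorem wedge_eq_zero_iff {u : Plane} (hu : u ≠ 0) (x : Plane) :
    wedge u x = 0 ↔ x ∈ Submodule.span ℝ {u} := by
  rw [Submodule.mem_span_singleton]
  constructor
  · intro h
    rw [wedge_apply] at h
    have hn : u 0 ^ 2 + u 1 ^ 2 ≠ 0 := by
      intro h0
      apply hu
      ext i; fin_cases i
      · show u 0 = 0
        nlinarith [sq_nonneg (u 0), sq_nonneg (u 1)]
      · show u 1 = 0
        nlinarith [sq_nonneg (u 0), sq_nonneg (u 1)]
    refine ⟨(u 0 * x 0 + u 1 * x 1) / (u 0 ^ 2 + u 1 ^ 2), ?_⟩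
    ext i; fin_cases i
    · simp only [Fin.zero_eta, PiLp.smul_apply, smul_eq_mul]
      field_simp
      linear_combination (u 1) * h
    · simp only [Fin.mk_one, PiLp.smul_apply, smul_eq_mul]
      field_simp
      linear_combination (-u 0) * h
  · rintro ⟨t, rfl⟩
    rw [map_smul, wedge_self, smul_zero]

/-- The projection onto `u^⊥` and `wedge u` have the same kernel, the line spanned by `u`, hence the
same fibres. -/
theorem projCard_eq_encard_levels {K : Set Plane} {u : Plane} (hu : u ∈ latticeZ2) (h0 : u ≠ 0) :
    projCard K u = (levels K u).encard := by
  rw [projCard, projPerp, encard_image_eq_of_fibers (g := wedge u)]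
  · rw [← (Int.cast_injective (α := ℝ)).encard_image (levels K u)]
    congr 1
    ext t
    constructor
    · rintro ⟨x, hx, rfl⟩
      obtain ⟨n, hn⟩ := exists_int_wedge hu hx.2
      exact ⟨n, ⟨x, hx, hn⟩, hn.symm⟩
    · rintro ⟨n, ⟨x, hx, hn⟩, rfl⟩
      exact ⟨x, hx, hn⟩
  · intro x y
    rw [← sub_eq_zero, ← map_sub, Submodule.starProjection_apply_eq_zero_iff,
      Submodule.orthogonal_orthogonal, ← wedge_eq_zero_iff h0, map_sub, sub_eq_zero]

theorem neg_mem_levels {K : Set Plane} (hs : K = -K) {u : Plane} {n : ℤ} (hn : n ∈ levels K u) :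
    -n ∈ levels K u := by
  obtain ⟨x, ⟨hx, hxl⟩, h⟩ := hn
  exact ⟨-x, ⟨by rw [hs]; simpa using hx, neg_mem_latticeZ2 hxl⟩, by simp [h]⟩

theorem add_levels_subset {K : Set Plane} (hc : Convex ℝ K) (u : Plane) :
    levels K u + levels K u ⊆ levels ((2 : ℝ) • K) u := by
  rintro _ ⟨a, ⟨x, ⟨hx, hxl⟩, ha⟩, b, ⟨y, ⟨hy, hyl⟩, hb⟩, rfl⟩
  refine ⟨x + y, ⟨⟨(1 / 2 : ℝ) • x + (1 / 2 : ℝ) • y, hc hx hy (by norm_num) (by norm_num)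
    (by norm_num), ?_⟩, add_mem_latticeZ2 hxl hyl⟩, by simp [ha, hb]⟩
  simp only
  module

theorem finite_levels {K : Set Plane} (hK : IsCompact K) (u : Plane) : (levels K u).Finite := by
  obtain ⟨C, hC⟩ := hK.exists_bound_of_continuousOn (wedge u).continuous.continuousOn
  refine (Set.finite_Icc (-⌊C⌋) ⌊C⌋).subset ?_
  rintro n ⟨x, hx, hn⟩
  have := hC x hx.1
  rw [hn, Real.norm_eq_abs, ← Int.cast_abs] at this
  exact abs_le.1 (Int.le_floor.2 this)

/-- Directions of an edge: every lattice line of the direction that meets the polygon contains a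
lattice point of the polygon. -/
theorem levels_eq_Icc {K : Set Plane} (hc : Convex ℝ K) (hs : K = -K) {u z v : Plane} {m N : ℤ}
    (hu : u ∈ latticeZ2) (hz : z ∈ latticeZ2) (huz : wedge u z = 1) (hm : 1 ≤ m)
    (hv : v ∈ K) (hw : v + (m : ℝ) • u ∈ K) (hN : wedge u v = N ∨ wedge u v = -N) (hN0 : 0 < N)
    (hb : ∀ x ∈ K, |wedge u x| ≤ N) : levels K u = Set.Icc (-N) N := by
  have hneg : ∀ x ∈ K, -x ∈ K := fun x hx => by rw [hs]; simpa using hx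
  have hm' : (1 : ℝ) ≤ m := by exact_mod_cast hm
  have hv1 : v + u ∈ K := by
    have := hc hv hw (a := 1 - (m : ℝ)⁻¹) (b := (m : ℝ)⁻¹)
      (by rw [sub_nonneg]; exact inv_le_one_of_one_le₀ hm') (by positivity) (by ring)
    rwa [show (1 - (m : ℝ)⁻¹) • v + (m : ℝ)⁻¹ • (v + (m : ℝ) • u) = v + u by
      rw [smul_add, smul_smul, inv_mul_cancel₀ (by positivity)]; module] at this
  -- The parallelogram with vertices `v`, `v + u`, `-v`, `-v - u` lies in `K`; its chords parallel
  -- to `u` are translates of `[0, u]`.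
  have hchord : ∀ l s : ℝ, -1 ≤ l → l ≤ 1 → -(1 - l) / 2 ≤ s → s ≤ (1 + l) / 2 →
      l • v + s • u ∈ K := by
    intro l s hl1 hl2 hs1 hs2
    set θ : ℝ := s + (1 - l) / 2 with hθ
    have hp : l • v + ((1 + l) / 2) • u ∈ K := by
      have := hc hv1 (hneg v hv) (a := (1 + l) / 2) (b := (1 - l) / 2) (by linarith) (by linarith)
        (by ring)
      convert this using 1; module
    have hn : l • v + (-(1 - l) / 2) • u ∈ K := by
      have := hc hv (hneg _ hv1) (a := (1 + l) / 2) (b := (1 - l) / 2) (by linarith) (by linarith)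
        (by ring)
      convert this using 1; module
    have := hc hp hn (a := θ) (b := 1 - θ) (by linarith) (by linarith) (by ring)
    convert this using 1
    rw [hθ]; module
  apply Set.Subset.antisymm
  · rintro n ⟨x, hx, hn⟩
    have := hb x hx.1
    rw [hn, ← Int.cast_abs, Int.cast_le] at this
    exact abs_le.1 this
  · intro n hn
    have hNr : (0 : ℝ) < N := by exact_mod_cast hN0
    have key : ∀ l : ℝ, -1 ≤ l → l ≤ 1 → l * wedge u v = n → n ∈ levels K u := by
      intro l hl1 hl2 hl
      set τ := wedge ((n : ℝ) • z - l • v) z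
      have hx := eq_of_wedge_eq_one huz ((n : ℝ) • z - l • v)
      rw [show wedge u ((n : ℝ) • z - l • v) = 0 by simp [huz, hl], zero_smul, zero_add] at hx
      -- Lattice points at level `n` are `n z + k u = l v + (τ + k) u`; the floor puts `τ + k` into
      -- the unit interval of the chord.
      refine ⟨(n : ℝ) • z + ((⌊(1 + l) / 2 - τ⌋ : ℤ) : ℝ) • u, ⟨?_, add_mem_latticeZ2
        (zsmul_mem_latticeZ2 hz _) (zsmul_mem_latticeZ2 hu _)⟩, by simp [huz, wedge_self]⟩
      have := hchord l (τ + (⌊(1 + l) / 2 - τ⌋ : ℤ)) hl1 hl2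
        (by linarith [Int.lt_floor_add_one ((1 + l) / 2 - τ)])
        (by linarith [Int.floor_le ((1 + l) / 2 - τ)])
      convert this using 1
      rw [add_smul, ← hx]; abel
    have h1 : -(N : ℝ) ≤ n := by exact_mod_cast hn.1
    have h2 : (n : ℝ) ≤ N := by exact_mod_cast hn.2
    rcases hN with hN | hN
    · refine key (n / N) ?_ ?_ ?_
      · rw [le_div_iff₀ hNr]; linarith
      · rw [div_le_iff₀ hNr]; linarith
      · rw [hN]; field_simp
    · refine key (-n / N) ?_ ?_ ?_
      · rw [le_div_iff₀ hNr]; linarith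
      · rw [div_le_iff₀ hNr]; linarith
      · rw [hN]; field_simp

/-- The lattice points of twice a body that contains `0` and two independent lattice points
generate the lattice. -/
theorem dvd_of_forall_levels {K : Set Plane} (hc : Convex ℝ K) (h0 : (0 : Plane) ∈ K)
    {u z v w : Plane} (hu : u ∈ latticeZ2) (hz : z ∈ latticeZ2) (huz : wedge u z = 1)
    (hv : v ∈ K) (hw : w ∈ K) (hvl : v ∈ latticeZ2) (hwl : w ∈ latticeZ2)
    (hvw : wedge v w ≠ 0) {d : ℤ} (hd : ∀ n ∈ levels ((2 : ℝ) • K) u, d ∣ n) : d ∣ 1 := by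
  have h2 : ∀ s t : ℝ, 0 ≤ s → s ≤ 1 → 0 ≤ t → t ≤ 1 → s • v + t • w ∈ (2 : ℝ) • K := by
    intro s t hs hs1 ht ht1
    refine ⟨(1 / 2 : ℝ) • (s • v) + (1 / 2 : ℝ) • (t • w),
      hc (hc.smul_mem_of_zero_mem h0 hv ⟨hs, hs1⟩) (hc.smul_mem_of_zero_mem h0 hw ⟨ht, ht1⟩)
      (by norm_num) (by norm_num) (by norm_num), ?_⟩
    simp only
    module
  set s := (wedge v w)⁻¹ * wedge z w
  set t := (wedge v w)⁻¹ * wedge v z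
  have hzst : z = s • v + t • w := by
    have := congrArg ((wedge v w)⁻¹ • ·) (wedge_smul_eq v w z)
    simpa [smul_smul, inv_mul_cancel₀ hvw, s, t] using this
  -- Reducing `z` modulo `v` and `w` gives a lattice point of the parallelogram they span, which
  -- lies in `2K`.
  set y := Int.fract s • v + Int.fract t • w with hy
  have hzy : z = y + ((⌊s⌋ : ℝ) • v + (⌊t⌋ : ℝ) • w) := by
    rw [hy, Int.fract, Int.fract]
    conv_lhs => rw [hzst]
    module
  have hyl : y ∈ latticeZ2 := by
    rw [eq_sub_of_add_eq hzy.symm]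
    exact sub_mem_latticeZ2 hz
      (add_mem_latticeZ2 (zsmul_mem_latticeZ2 hvl _) (zsmul_mem_latticeZ2 hwl _))
  have hdvd : ∀ x ∈ (2 : ℝ) • K, x ∈ latticeZ2 → ∃ k : ℤ, wedge u x = d * k := by
    intro x hx hxl
    obtain ⟨n, hn⟩ := exists_int_wedge hu hxl
    obtain ⟨k, hk⟩ := hd n ⟨x, ⟨hx, hxl⟩, hn⟩
    exact ⟨k, by rw [hn, hk]; simp⟩
  obtain ⟨a, ha⟩ := hdvd y (h2 _ _ (Int.fract_nonneg _) (Int.fract_lt_one _).le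
    (Int.fract_nonneg _) (Int.fract_lt_one _).le) hyl
  obtain ⟨b, hb⟩ := hdvd v (by simpa using h2 1 0) hvl
  obtain ⟨c, hc'⟩ := hdvd w (by simpa using h2 0 1) hwl
  refine ⟨a + ⌊s⌋ * b + ⌊t⌋ * c, ?_⟩
  have : wedge u z = d * (a + ⌊s⌋ * b + ⌊t⌋ * c) := by
    rw [hzy, map_add, ha, map_add, map_smul, map_smul, hb, hc', smul_eq_mul, smul_eq_mul]; ring
  rw [huz] at this
  exact_mod_cast this

/-! ### Sumsets of integers. -/

/-- Equality case of `|A + A| ≥ 2 |A| - 1`: the set is an arithmetic progression. -/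
theorem exists_eq_image_of_card_add_self_le {A : Finset ℤ} {k : ℕ} (hA : A.card = k + 1)
    (hAA : (A + A).card ≤ 2 * k + 1) :
    ∃ a d : ℤ, A = (Finset.range (k + 1)).image (fun i : ℕ => a + d * i) := by
  obtain ⟨e, hmono, himg⟩ : ∃ e : ℕ → ℤ, (∀ i j, i < j → j ≤ k → e i < e j) ∧
      A = (Finset.range (k + 1)).image e := by
    refine ⟨fun i => if h : i < k + 1 then A.orderEmbOfFin hA ⟨i, h⟩ else 0, ?_, ?_⟩
    · intro i j hij hj
      simp only [show i < k + 1 by omega, show j < k + 1 by omega, dif_pos]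
      exact (A.orderEmbOfFin hA).strictMono hij
    · ext x
      rw [← Finset.mem_coe, ← Finset.range_orderEmbOfFin A hA]
      simp only [Set.mem_range, Finset.mem_image, Finset.mem_range]
      constructor
      · rintro ⟨i, rfl⟩; exact ⟨i, i.2, dif_pos i.2⟩
      · rintro ⟨i, hi, rfl⟩; exact ⟨⟨i, hi⟩, by simp [hi]⟩
  have hmem : ∀ i ≤ k, e i ∈ A := fun i hi => by
    rw [himg]; exact Finset.mem_image_of_mem _ (Finset.mem_range.2 (by omega))
  -- The chain `2e₀ < e₀ + e₁ < 2e₁ < e₁ + e₂ < ...` has `2k + 1` terms, so it exhausts `A + A`.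
  set c : ℕ → ℤ := fun j => e (j / 2) + e ((j + 1) / 2) with hc
  have hle : ∀ i j, i ≤ j → j ≤ k → e i ≤ e j := fun i j hij hj => by
    rcases hij.eq_or_lt with rfl | h
    · rfl
    · exact (hmono i j h hj).le
  have hcm : ∀ i j, i < j → j ≤ 2 * k → c i < c j := by
    intro i j hij hj
    by_cases h : i / 2 < j / 2
    · exact add_lt_add_of_lt_of_le (hmono _ _ h (by omega)) (hle _ _ (by omega) (by omega))
    · exact add_lt_add_of_le_of_lt (hle _ _ (by omega) (by omega))
        (hmono _ _ (by omega) (by omega))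
  have hcinj : Set.InjOn c (Finset.range (2 * k + 1)) := by
    intro i hi j hj hij
    simp only [Finset.coe_range, Set.mem_Iio] at hi hj
    rcases lt_trichotomy i j with h | h | h
    · exact absurd hij (hcm i j h (by omega)).ne
    · exact h
    · exact absurd hij (hcm j i h (by omega)).ne'
  have hsub : (Finset.range (2 * k + 1)).image c ⊆ A + A := by
    intro x hx
    obtain ⟨j, hj, rfl⟩ := Finset.mem_image.1 hx
    rw [Finset.mem_range] at hj
    exact Finset.add_mem_add (hmem _ (by omega)) (hmem _ (by omega))
  have heq := Finset.eq_of_subset_of_card_le hsub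
    (by rw [Finset.card_image_of_injOn hcinj, Finset.card_range]; exact hAA)
  -- This sum lies strictly between `e i + e (i + 1)` and `e (i + 1) + e (i + 2)`, where the chain
  -- has only the term `2 * e (i + 1)`.
  have hstep : ∀ i, i + 2 ≤ k → e i + e (i + 2) = 2 * e (i + 1) := by
    intro i hi
    have hx : e i + e (i + 2) ∈ A + A := Finset.add_mem_add (hmem _ (by omega)) (hmem _ hi)
    rw [← heq] at hx
    obtain ⟨j, hj, hje⟩ := Finset.mem_image.1 hx
    rw [Finset.mem_range] at hj
    have h1 : c (2 * i + 1) = e i + e (i + 1) := by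
      simp only [hc]
      rw [show (2 * i + 1) / 2 = i by omega, show (2 * i + 1 + 1) / 2 = i + 1 by omega]
    have h2 : c (2 * i + 2) = e (i + 1) + e (i + 1) := by
      simp only [hc]
      rw [show (2 * i + 2) / 2 = i + 1 by omega, show (2 * i + 2 + 1) / 2 = i + 1 by omega]
    have h3 : c (2 * i + 3) = e (i + 1) + e (i + 2) := by
      simp only [hc]
      rw [show (2 * i + 3) / 2 = i + 1 by omega, show (2 * i + 3 + 1) / 2 = i + 2 by omega]
    have m1 := hmono i (i + 1) (by omega) (by omega)
    have m2 := hmono (i + 1) (i + 2) (by omega) (by omega)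
    have hj1 : 2 * i + 1 < j := by
      by_contra! h
      rcases h.eq_or_lt with rfl | h
      · omega
      · have := hcm j (2 * i + 1) h (by omega); omega
    have hj2 : j < 2 * i + 3 := by
      by_contra! h
      rcases h.eq_or_lt with rfl | h
      · omega
      · have := hcm (2 * i + 3) j h (by omega); omega
    obtain rfl : j = 2 * i + 2 := by omega
    omega
  have hform : ∀ i, (i ≤ k → e i = e 0 + (e 1 - e 0) * i) ∧
      (i + 1 ≤ k → e (i + 1) = e 0 + (e 1 - e 0) * (i + 1 : ℕ)) := by
    intro i
    induction i with
    | zero => simp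
    | succ i ih =>
      refine ⟨ih.2, fun h => ?_⟩
      have h1 := ih.1 (by omega)
      have h2 := ih.2 (by omega)
      have h3 := hstep i h
      push_cast at *
      linear_combination h3 - h1 + 2 * h2
  refine ⟨e 0, e 1 - e 0, ?_⟩
  rw [himg]
  refine Finset.image_congr fun i hi => ?_
  simp only [Finset.coe_range, Set.mem_Iio] at hi
  exact (hform i).1 (by omega)

/-- Symmetry makes the elements of the progression sum to zero, so its middle term is `0`. -/
theorem abs_le_and_dvd_of_card_add_self_le {A : Finset ℤ} {N : ℕ} (hs : ∀ a ∈ A, -a ∈ A)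
    (hA : A.card = 2 * N + 1) (hAA : (A + A).card ≤ 4 * N + 1) :
    ∃ d : ℤ, (∀ a ∈ A, |a| ≤ |d| * N) ∧ ∀ a ∈ A, d ∣ a := by
  obtain ⟨a, d, rfl⟩ := exists_eq_image_of_card_add_self_le hA (by omega)
  have hsum : a = -(d * N) := by
    have h1 : ∑ x ∈ (Finset.range (2 * N + 1)).image (fun i : ℕ => a + d * i), x = 0 :=
      Finset.sum_involution (fun x _ => -x) (by simp) (fun x _ hx h => hx (by omega))
        (fun x hx => hs x hx) (by simp)
    rw [Finset.sum_image (Finset.card_image_iff.1 (by rw [hA, Finset.card_range])),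
      Finset.sum_add_distrib, ← Finset.mul_sum, Finset.sum_const, Finset.card_range,
      ← Nat.cast_sum] at h1
    have h2 := Finset.sum_range_id_mul_two (2 * N + 1)
    have h3 : ((∑ i ∈ Finset.range (2 * N + 1), i : ℕ) : ℤ) * 2 = (2 * N + 1) * (2 * N) := by
      exact_mod_cast h2
    have h4 : ((2 * (2 * N + 1) : ℕ) : ℤ) * (a + d * N) = 0 := by
      rw [nsmul_eq_mul] at h1
      push_cast at h1 h3 ⊢
      linear_combination 2 * h1 - d * h3
    rcases mul_eq_zero.1 h4 with h | h
    · omega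
    · linarith
  refine ⟨d, fun x hx => ?_, fun x hx => ?_⟩ <;>
    obtain ⟨i, hi, rfl⟩ := Finset.mem_image.1 hx
  · rw [Finset.mem_range] at hi
    rw [hsum, show -(d * N) + d * i = d * ((i : ℤ) - N) by ring, abs_mul]
    exact mul_le_mul_of_nonneg_left (abs_le.2 ⟨by omega, by omega⟩) (abs_nonneg d)
  · exact ⟨i - N, by rw [hsum]; ring⟩

/-! ### Comparison of the two polygons. -/

theorem exists_independent_vertices {V : Set Plane} (hV : V.Finite)
    (h0 : (0 : Plane) ∈ interior (convexHull ℝ V)) : ∃ v ∈ V, ∃ w ∈ V, wedge v w ≠ 0 := by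
  obtain ⟨p, hp⟩ : ∃ p, p ∉ convexHull ℝ V := by
    by_contra! h
    have := (hV.isCompact_convexHull (𝕜 := ℝ))
    rw [Set.eq_univ_of_forall h] at this
    exact noncompact_univ Plane this
  obtain ⟨_, _, _, v, hv, w, hw, _, _, h⟩ := exists_separating_edge hV h0 hp
  exact ⟨v, hv, w, hw, h⟩

theorem subset_of_sameProjCards {K L : Set Plane}
    (hK : IsConvexIntegerPolygon K) (hL : IsConvexIntegerPolygon L)
    (hKs : K = -K) (hLs : L = -L)
    (h : ∀ u ∈ latticeZ2, IsEdgeDirection K u → SameProjCards K L u) : L ⊆ K := by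
  obtain ⟨⟨V, hV, hVl, hKV⟩, hKi⟩ := hK
  obtain ⟨⟨W, hW, hWl, hLW⟩, hLi⟩ := hL
  have hKc : Convex ℝ K := hKV ▸ convex_convexHull ℝ V
  have hLc : Convex ℝ L := hLW ▸ convex_convexHull ℝ W
  have hKcpt : IsCompact K := hKV ▸ hV.isCompact_convexHull (𝕜 := ℝ)
  have hLcpt : IsCompact L := hLW ▸ hW.isCompact_convexHull (𝕜 := ℝ)
  have hK0 := zero_mem_interior_of_eq_neg hKc hKs hKi
  have hL0 := zero_mem_interior_of_eq_neg hLc hLs hLi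
  have hWL : W ⊆ L := hLW ▸ subset_convexHull ℝ W
  have hVK : V ⊆ K := hKV ▸ subset_convexHull ℝ V
  suffices W ⊆ K by rw [hLW]; exact convexHull_min this hKc
  intro p hpW
  by_contra hp
  obtain ⟨q, hq, hqp, v, hv, w, hw, hqv, hqw, hvw⟩ :=
    exists_separating_edge hV (hKV ▸ hK0) (hKV ▸ hp)
  rw [← hKV] at hq
  have hne : w - v ≠ 0 := fun h0 => by
    rw [sub_eq_zero.1 h0, wedge_self] at hvw; exact hvw rfl
  obtain ⟨u, hu, z, hz, m, hm, hmu, huz⟩ :=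
    exists_primitive (sub_mem_latticeZ2 (hVl hw) (hVl hv)) hne
  have hu0 : u ≠ 0 := by rintro rfl; simp [wedge_apply] at huz
  obtain ⟨hcard, hcard2⟩ := h u hu (isEdgeDirection_of_support hKc hKcpt hq (hVK hv) (hVK hw)
    hqv hqw hvw hu0 ⟨m, hmu⟩)
  have hqu : wedge q u = 0 := by
    have := congrArg (wedge q) hmu
    rw [map_smul, map_sub, hqv, hqw, sub_self, smul_eq_mul] at this
    exact (mul_eq_zero.1 this).resolve_left (by positivity)
  have hqx : ∀ x, wedge q x = wedge u x * wedge q z := fun x => by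
    conv_lhs => rw [eq_of_wedge_eq_one huz x]
    simp [hqu]
  obtain ⟨c, hc⟩ := exists_int_wedge hu (hVl hv)
  have hcz : (c : ℝ) * wedge q z = 1 := by rw [← hc, ← hqx, hqv]
  -- The edge line `wedge q = 1` is the lattice line `wedge u = c`, so `N = |c|` is its number of
  -- lattice steps from `0`.
  have hux : ∀ x, wedge u x = c * wedge q x := fun x => by
    rw [hqx]; linear_combination (-wedge u x) * hcz
  have hc0 : c ≠ 0 := by rintro rfl; simp at hcz
  set N : ℕ := c.natAbs with hNdef
  have hN0 : 0 < N := Int.natAbs_pos.2 hc0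
  have hNr : ((N : ℤ) : ℝ) = |(c : ℝ)| := by rw [hNdef, Int.natCast_natAbs, Int.cast_abs]
  have hbound : ∀ x ∈ K, |wedge u x| ≤ ((N : ℤ) : ℝ) := by
    intro x hx
    have h1 := hq x hx
    have h2 := hq (-x) (by rw [hKs]; simpa using hx)
    rw [map_neg] at h2
    rw [hux, abs_mul, hNr]
    exact mul_le_of_le_one_right (abs_nonneg _) (abs_le.2 ⟨by linarith, h1⟩)
  have hlev : levels K u = Set.Icc (-(N : ℤ)) N := by
    refine levels_eq_Icc hKc hKs hu hz huz hm (hVK hv) ?_ ?_ (by exact_mod_cast hN0) hbound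
    · rw [hmu, add_sub_cancel]; exact hVK hw
    · rw [hc, hNr]
      rcases abs_choice (c : ℝ) with h | h <;> rw [h] <;> simp
  have hlev2 : levels ((2 : ℝ) • K) u ⊆ Set.Icc (-(2 * N : ℤ)) (2 * N) := by
    rintro n ⟨_, ⟨⟨x, hx, rfl⟩, -⟩, hn⟩
    have := hbound x hx
    simp only [map_smul, smul_eq_mul] at hn
    have h2 : |(n : ℝ)| ≤ ((2 * N : ℤ) : ℝ) := by
      rw [← hn, abs_mul, abs_two]; push_cast at this ⊢; linarith
    rw [← Int.cast_abs, Int.cast_le] at h2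
    exact abs_le.1 h2
  rw [projCard_eq_encard_levels hu hu0, projCard_eq_encard_levels hu hu0] at hcard hcard2
  have hfin : (levels L u).Finite := finite_levels hLcpt u
  have hfin2 : (levels ((2 : ℝ) • L) u).Finite := finite_levels (hLcpt.smul 2) u
  lift levels L u to Finset ℤ using hfin with A hA
  lift levels ((2 : ℝ) • L) u to Finset ℤ using hfin2 with B hB
  have hAcard : A.card = 2 * N + 1 := by
    rw [hlev, ← Finset.coe_Icc, Set.encard_coe_eq_coe_finsetCard, Int.card_Icc,
      Set.encard_coe_eq_coe_finsetCard, Nat.cast_inj] at hcard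
    omega
  have hBcard : B.card ≤ 4 * N + 1 := by
    have := Set.encard_le_encard hlev2
    rw [hcard2, ← Finset.coe_Icc, Set.encard_coe_eq_coe_finsetCard,
      Set.encard_coe_eq_coe_finsetCard, Nat.cast_le, Int.card_Icc] at this
    omega
  have hsub : A + A ⊆ B := by
    rw [← Finset.coe_subset, Finset.coe_add, hA, hB]; exact add_levels_subset hLc u
  have hsymm : ∀ a ∈ A, -a ∈ A := fun a ha => by
    rw [← Finset.mem_coe, hA] at ha ⊢; exact neg_mem_levels hLs ha
  obtain ⟨d, hdabs, hddvd⟩ := abs_le_and_dvd_of_card_add_self_le hsymm hAcard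
    ((Finset.card_le_card hsub).trans hBcard)
  -- The lower bound `|A + A| ≥ 2|A| - 1 = 4N + 1` meets the upper bound on `|B|`.
  have hBA : A + A = B := by
    refine Finset.eq_of_subset_of_card_le hsub (hBcard.trans ?_)
    have hne : A.Nonempty := Finset.card_pos.1 (by omega)
    have := cauchy_davenport_of_isAddTorsionFree hne hne
    omega
  obtain ⟨a, ha, b, hb, hab⟩ := exists_independent_vertices hW (hLW ▸ hL0)
  have hd1 : d ∣ 1 := by
    refine dvd_of_forall_levels hLc (interior_subset hL0) hu hz huz (hWL ha) (hWL hb)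
      (hWl ha) (hWl hb) hab fun n hn => ?_
    rw [← hB, Finset.mem_coe, ← hBA] at hn
    obtain ⟨i, hi, j, hj, rfl⟩ := Finset.mem_add.1 hn
    exact dvd_add (hddvd i hi) (hddvd j hj)
  obtain ⟨n, hn⟩ := exists_int_wedge hu (hWl hpW)
  have hnA : n ∈ A := by rw [← Finset.mem_coe, hA]; exact ⟨p, ⟨hWL hpW, hWl hpW⟩, hn⟩
  have hle := hdabs n hnA
  rw [Int.isUnit_iff_abs_eq.1 (isUnit_of_dvd_one hd1), one_mul] at hle
  have hle' : |(n : ℝ)| ≤ ((N : ℤ) : ℝ) := by rw [← Int.cast_abs]; exact_mod_cast hle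
  -- The level of `p` has absolute value `|c| * wedge q p`, which exceeds `|c| = N` because `1 <
  -- wedge q p`.
  rw [← hn, hux, abs_mul, hNr, abs_of_pos (by linarith : 0 < wedge q p)] at hle'
  have : 0 < |(c : ℝ)| := abs_pos.2 (by exact_mod_cast hc0)
  nlinarith

theorem theorem1p2 (K L : Set Plane)
    (hK : IsConvexIntegerPolygon K) (hL : IsConvexIntegerPolygon L)
    (hKs : K = -K) (hLs : L = -L) :
    ((∀ u ∈ latticeZ2, u ≠ 0 → SameProjCards K L u) → K = L) ∧
    ((∀ u ∈ latticeZ2, IsEdgeDirection K u ∨ IsEdgeDirection L u → SameProjCards K L u) →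
      (∃ ξ ∈ latticeZ2 \ (D1 K ∪ D1 L), SameProjCards K L ξ) → K = L) := by
  have key : (∀ u ∈ latticeZ2, IsEdgeDirection K u ∨ IsEdgeDirection L u →
      SameProjCards K L u) → K = L := fun h =>
    Set.Subset.antisymm
      (subset_of_sameProjCards hL hK hLs hKs fun u hu he =>
        ⟨(h u hu (.inr he)).1.symm, (h u hu (.inr he)).2.symm⟩)
      (subset_of_sameProjCards hK hL hKs hLs fun u hu he => h u hu (.inl he))
  exact ⟨fun h => key fun u hu he => h u hu (he.elim (·.1) (·.1)), fun h _ => key h⟩
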